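/- Let $K$ be a compact Hausdorff space. Let $\Sigma_C$ be the $\sigma$-algebra of subsets of $K$ with the property of Baire (sets $U\Delta N$ with $U$ open and $N$ meagre), and let $L$ be the vector lattice of bounded real-valued $\Sigma_C$-measurable functions on $K$ modulo equality off a meagre set, ordered by $\hat u\le\hat v$ iff $\{x: u(x)>v(x)\}$ is meagre. Let $C(K)^\delta$ be the Dedekind completion of $C(K)$, i.e. a Dedekind complete Banach lattice containing $C(K)$ isometrically as an order dense, majorizing vector sublattice. Then there is a unique linear lattice isomorphism of $C(K)^\delta$ onto $L$ sending each $f\in C(K)$ to its class $\hat f$; we identify $C(K)^\delta$ with $L$ through it. Let $\varphi$ be a bounded linear functional on $C(K)^\delta$. Then there is a unique bounded finitely additive signed measure $\mu$ on $\Sigma_C$, vanishing on all meagre sets, such that $\varphi(\hat u)=\int_K u\,d\mu$ for every bounded $\Sigma_C$-measurable $u:K\to\mathbb R$, and the following are equivalent: 1. $\varphi$ is order continuous, i.e. $\inf\{|\varphi(f)| : f\in D\}=0$ for every nonempty downward directed set $D\subseteq C(K)^\delta$ with $\inf D=0$; 2. $\mu$ is countably additive on $\Sigma_C$ and regular, i.e.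 for every Borel set $B\subseteq K$, $$\sup\{|\mu|(C): C\subseteq B\text{ compact}\}=|\mu|(B)=\inf\{|\mu|(U): U\supseteq B\text{ open}\};$$ 3. $\mu$ is countably additive on $\Sigma_C$ and regular on $\Sigma_C$, i.e. the identities in 2 hold for every $B\in\Sigma_C$. Here $|\mu|$ is the modulus of $\mu$, $|\mu|(A)=\sup\{\mu(B)-\mu(A\setminus B): B\in\Sigma_C,\ B\subseteq A\}$. -/

import Mathlib

open Set Filter Topology MeasureTheory

noncomputable section

namespace CKDual

/-! ### Dedekind completions and order continuous functionals -/

/-- The linear isometry `ι : F → E` exhibits the Banach lattice `E` as the Dedekind completion of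
the normed lattice `F`: `E` is Dedekind complete, `ι` preserves the lattice operations (so that its
range is a vector sublattice), and the range of `ι` is order dense and majorizing in `E`. -/
structure IsDedekindCompletion {F E : Type*}
    [NormedAddCommGroup F] [Lattice F] [NormedSpace ℝ F]
    [NormedAddCommGroup E] [Lattice E] [NormedSpace ℝ E] (ι : F →ₗᵢ[ℝ] E) : Prop where
  map_sup : ∀ f g : F, ι (f ⊔ g) = ι f ⊔ ι g
  map_inf : ∀ f g : F, ι (f ⊓ g) = ι f ⊓ ι g
  order_dense : ∀ e : E, 0 < e → ∃ g : F, 0 < ι g ∧ ι g ≤ e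
  majorizing : ∀ e : E, 0 ≤ e → ∃ g : F, e ≤ ι g
  dedekind_complete_above : ∀ A : Set E, A.Nonempty → BddAbove A → ∃ s, IsLUB A s
  dedekind_complete_below : ∀ A : Set E, A.Nonempty → BddBelow A → ∃ s, IsGLB A s

/-- `φ` is order continuous: `inf {|φ f| : f ∈ D} = 0` for every (nonempty) downward directed set
`D` with `inf D = 0`. -/
def OrderContinuous {E : Type*} [NormedAddCommGroup E] [Lattice E] [NormedSpace ℝ E]
    (φ : StrongDual ℝ E) : Prop :=
  ∀ D : Set E, D.Nonempty → DirectedOn (fun x y => y ≤ x) D → IsGLB D 0 →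
    IsGLB ((fun f => |φ f|) '' D) 0

/-! ### Sets with the property of Baire, and functions modulo meagre sets -/

variable (K : Type*) [TopologicalSpace K]

/-- The σ-algebra of subsets of `K` with the property of Baire. -/
abbrev catAlg : MeasurableSpace K := eventuallyMeasurableSpace (borel K) (residual K)

/-- Membership in `catAlg K` is the property of Baire: being of the form `U ∆ N`
with `U` open and `N` meagre. -/
theorem measurableSet_catAlg_iff (A : Set K) :
    MeasurableSet[catAlg K] A ↔ ∃ U N : Set K, IsOpen U ∧ IsMeagre N ∧ A = symmDiff U N := by
  have key : ∀ U : Set K, A =ᶠ[residual K] U ↔ IsMeagre (symmDiff U A) := by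
    intro U
    rw [IsMeagre, Filter.eventuallyEq_set, Filter.Eventually]
    have : {x | x ∈ A ↔ x ∈ U} = (symmDiff U A)ᶜ := by
      ext x
      simp only [Set.mem_ofPred_eq, Set.mem_compl_iff, Set.mem_symmDiff]
      tauto
    rw [this]
  constructor
  · intro h
    obtain ⟨U, hU, hAU⟩ := BaireMeasurableSet.iff_residualEq_isOpen.1 h
    exact ⟨U, symmDiff U A, hU, (key U).1 hAU, by simp⟩
  · rintro ⟨U, N, hU, hN, rfl⟩
    refine BaireMeasurableSet.iff_residualEq_isOpen.2 ⟨U, hU, (key U).2 ?_⟩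
    simpa using hN

/-- The space of bounded real-valued functions on `K` that are measurable with respect to the
σ-algebra of sets with the property of Baire. -/
def CatB : Submodule ℝ (K → ℝ) where
  carrier := {u | Measurable[catAlg K] u ∧ ∃ M : ℝ, ∀ x, |u x| ≤ M}
  zero_mem' := ⟨@measurable_const _ _ _ (catAlg K) 0, 0, fun x => by simp⟩
  add_mem' := by
    rintro u v ⟨hu, M, hM⟩ ⟨hv, N, hN⟩
    let _ := catAlg K
    refine ⟨Measurable.add hu hv, M + N, fun x => ?_⟩
    exact (abs_add_le _ _).trans (add_le_add (hM x) (hN x))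
  smul_mem' := by
    rintro c u ⟨hu, M, hM⟩
    let _ := catAlg K
    refine ⟨Measurable.const_smul hu c, |c| * M, fun x => ?_⟩
    simp only [Pi.smul_apply, smul_eq_mul, abs_mul]
    exact mul_le_mul_of_nonneg_left (hM x) (abs_nonneg c)

/-- The linear map sending a function to its class modulo equality off a meagre set. The order on
`Filter.Germ (residual K) ℝ` is: `û ≤ v̂` iff `{x | u x > v x}` is meagre. -/
def germLinearMap : (K → ℝ) →ₗ[ℝ] Germ (residual K) ℝ where
  toFun u := (u : Germ (residual K) ℝ)
  map_add' _ _ := rfl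
  map_smul' _ _ := rfl

/-- The vector lattice of classes, modulo equality off a meagre set, of bounded functions
measurable with respect to the sets with the property of Baire; it carries the order of
`Filter.Germ (residual K) ℝ`. -/
abbrev CatL : Type _ := ↥((CatB K).map (germLinearMap K))

variable {K}

/-- The class `û` of `u`. -/
def toCatL (u : CatB K) : CatL K := ⟨germLinearMap K u, u, u.2, rfl⟩

/-- The order on classes: `û ≤ v̂` iff `{x | u x > v x}` is meagre. -/
theorem toCatL_le_iff (u v : CatB K) :
    toCatL u ≤ toCatL v ↔ IsMeagre {x | (u : K → ℝ) x > (v : K → ℝ) x} := by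
  have h : toCatL u ≤ toCatL v ↔ ∀ᶠ x in residual K, (u : K → ℝ) x ≤ (v : K → ℝ) x :=
    Germ.coe_le
  rw [h, IsMeagre, Filter.Eventually]
  have : {x | (u : K → ℝ) x > (v : K → ℝ) x}ᶜ = {x | (u : K → ℝ) x ≤ (v : K → ℝ) x} := by
    ext x; simp
  rw [this]

/-- A continuous function on a compact space, as an element of `CatB K`. -/
def ofCont [CompactSpace K] (f : C(K, ℝ)) : CatB K :=
  ⟨f, by
    have h : Measurable[borel K] (f : K → ℝ) :=
      by
      let _ := borel K
      have _h : BorelSpace K := ⟨rfl⟩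
      exact f.continuous.measurable
    exact ⟨fun s hs => (h hs).eventuallyMeasurableSet, ‖f‖, fun x => f.norm_coe_le_norm x⟩⟩

/-! ### Finitely additive measures vanishing on meagre sets -/

variable (K) in
/-- A bounded, finitely additive signed measure on the sets with the property of Baire which
vanishes on all meagre sets. By convention its value is `0` at sets outside the σ-algebra. -/
@[ext]
structure CatFam where
  toFun : Set K → ℝ
  not_measurable : ∀ A, ¬ MeasurableSet[catAlg K] A → toFun A = 0
  additive : ∀ A B, MeasurableSet[catAlg K] A → MeasurableSet[catAlg K] B → Disjoint A B →
    toFun (A ∪ B) = toFun A + toFun B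
  bounded : ∃ M : ℝ, ∀ A, MeasurableSet[catAlg K] A → |toFun A| ≤ M
  meagre : ∀ N, IsMeagre N → toFun N = 0

namespace CatFam

/-- Countable additivity. -/
def CountablyAdditive (μ : CatFam K) : Prop :=
  ∀ A : ℕ → Set K, (∀ n, MeasurableSet[catAlg K] (A n)) → Pairwise (Function.onFun Disjoint A) →
    HasSum (fun n => μ.toFun (A n)) (μ.toFun (⋃ n, A n))

/-- The modulus `|μ| = μ ∨ (-μ)` on a set `A` with the property of Baire:
`|μ|(A) = sup {μ(B) - μ(A \ B) : B ⊆ A}`, with `B` ranging over sets with the property of Baire.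
(Since `μ` is bounded, this is the supremum of a nonempty bounded set of reals.) -/
def absVal (μ : CatFam K) (A : Set K) : ℝ :=
  sSup {r | ∃ B, MeasurableSet[catAlg K] B ∧ B ⊆ A ∧ r = μ.toFun B - μ.toFun (A \ B)}

/-- `μ` is regular on the class `S` of sets: for `B ∈ S`,
`sup {|μ|(C) : C ⊆ B compact} = |μ|(B) = inf {|μ|(U) : U ⊇ B open}`. -/
def RegularOn (μ : CatFam K) (S : Set (Set K)) : Prop :=
  ∀ B ∈ S, IsLUB (μ.absVal '' {C | C ⊆ B ∧ IsCompact C}) (μ.absVal B) ∧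
    IsGLB (μ.absVal '' {U | B ⊆ U ∧ IsOpen U}) (μ.absVal B)

/-- The integral of a simple function. -/
def simpleIntegral (μ : CatFam K) (s : @SimpleFunc K (catAlg K) ℝ) : ℝ :=
  ∑ y ∈ @SimpleFunc.range K ℝ (catAlg K) s, y * μ.toFun (s ⁻¹' {y})

/-- `∫ u dμ = c` for a bounded measurable `u`: the integrals of simple functions converge to `c`
as the simple functions converge uniformly to `u`. -/
def HasIntegral (μ : CatFam K) (u : CatB K) (c : ℝ) : Prop :=
  ∀ ε > 0, ∃ δ > 0, ∀ s : @SimpleFunc K (catAlg K) ℝ,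
    (∀ x, |s x - (u : K → ℝ) x| ≤ δ) → |μ.simpleIntegral s - c| ≤ ε

/-- Bounded measurable functions are uniform limits of simple functions. -/
theorem exists_simpleFunc_near (u : CatB K) {δ : ℝ} (hδ : 0 < δ) :
    ∃ s : @SimpleFunc K (catAlg K) ℝ, ∀ x, |s x - (u : K → ℝ) x| ≤ δ := by
  let _ := catAlg K
  obtain ⟨hu, M, hM⟩ := u.2
  have hm : Measurable fun x => ⌊(u : K → ℝ) x / δ⌋ := (hu.div_const δ).floor
  refine ⟨⟨fun x => (⌊(u : K → ℝ) x / δ⌋ : ℝ) * δ, fun y => ?_, ?_⟩, fun x => ?_⟩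
  · exact ((measurable_from_top (f := fun n : ℤ => (n : ℝ) * δ)).comp hm)
      (measurableSet_singleton y)
  · refine ((Set.finite_Icc ⌊-M / δ⌋ ⌊M / δ⌋).image (fun n : ℤ => (n : ℝ) * δ)).subset ?_
    rintro _ ⟨x, rfl⟩
    have h := abs_le.1 (hM x)
    exact ⟨_, ⟨Int.floor_le_floor (by gcongr; exact h.1),
      Int.floor_le_floor (by gcongr; exact h.2)⟩, rfl⟩
  · have h1 := Int.floor_le ((u : K → ℝ) x / δ)
    have h2 := Int.lt_floor_add_one ((u : K → ℝ) x / δ)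
    rw [le_div_iff₀ hδ] at h1
    rw [div_lt_iff₀ hδ] at h2
    change |(⌊(u : K → ℝ) x / δ⌋ : ℝ) * δ - (u : K → ℝ) x| ≤ δ
    rw [abs_le]
    constructor <;> nlinarith

/-- The value of the integral is unique. -/
theorem HasIntegral.unique {μ : CatFam K} {u : CatB K} {c d : ℝ}
    (hc : μ.HasIntegral u c) (hd : μ.HasIntegral u d) : c = d := by
  refine eq_of_abs_sub_le_all fun ε hε => ?_
  obtain ⟨δ₁, h₁, H₁⟩ := hc (ε / 2) (by positivity)
  obtain ⟨δ₂, h₂, H₂⟩ := hd (ε / 2) (by positivity)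
  obtain ⟨s, hs⟩ := exists_simpleFunc_near u (lt_min h₁ h₂)
  have a := abs_le.1 (H₁ s fun x => (hs x).trans (min_le_left _ _))
  have b := abs_le.1 (H₂ s fun x => (hs x).trans (min_le_right _ _))
  rw [abs_le]
  constructor <;> linarith [a.1, a.2, b.1, b.2]

end CatFam

/-! ### The measure of a functional on the Dedekind completion -/

section

variable [CompactSpace K] {E : Type*} [NormedAddCommGroup E] [Lattice E] [NormedSpace ℝ E]

/-- `T` identifies `E` with `CatL K`: it is a linear order isomorphism (hence a lattice
isomorphism) which is compatible with the embeddings of `C(K)`. -/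
def IsIdentification (ι : C(K, ℝ) →ₗᵢ[ℝ] E) (T : E ≃ₗ[ℝ] CatL K) : Prop :=
  (∀ x y : E, T x ≤ T y ↔ x ≤ y) ∧ ∀ f : C(K, ℝ), T (ι f) = toCatL (ofCont f)

/-- `μ` is the measure of the functional `φ` on `E`: `φ(û) = ∫ u dμ` for all `u`, where `E` is
identified with `CatL K` through `T`. -/
def Represents (T : E ≃ₗ[ℝ] CatL K) (μ : CatFam K) (φ : StrongDual ℝ E) : Prop :=
  ∀ u : CatB K, μ.HasIntegral u (φ (T.symm (toCatL u)))

end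

end CKDual

end

noncomputable section

namespace CKDual

variable {K : Type*} [TopologicalSpace K]

/-! ### Classes modulo meagre sets -/

/-! The isomorphism sends `e` to the class of its lower envelope, the pointwise supremum of the
continuous functions below `e`. This envelope is lower semicontinuous, hence measurable. The lower
envelope is superadditive and the upper one subadditive, so linearity follows once the two agree off
a meagre set (`upperEnvelope_eventuallyEq`). If they did not, `exists_continuousMap_pos_le` would
put a continuous `h > 0` below their difference, off a meagre set. Then `h` could be added again and
again to a function below `e`, against boundedness. The same iteration gives surjectivity.
Uniqueness holds because `e` is the supremum of the continuous functions below it.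

The measure must be `μ(A) = φ(1_A)`. If `φ` is order continuous, indicators of the tails of a
disjoint union decrease to `0`, which gives countable additivity. Indicators of the open
neighbourhoods of a closed nowhere dense set also decrease to `0` in the quotient, so such a set has
neighbourhoods of small `|μ|`. Covering a meagre set and the boundary of an open set in this way
gives inner regularity on all of `catAlg K`, and complements give outer regularity.

Conversely, let `D` decrease to `0`. The points where every continuous majorant of a member of `D`
is at least `δ` form a closed nowhere dense set, which is `|μ|`-null. Outer regularity encloses it
in an open `U` of small `|μ|`. By compactness one member of `D` is below `δ` off `U`, and its
integral is split along `U` and `Uᶜ`. -/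

theorem toCatL_le_iff_eventually {u v : CatB K} :
    toCatL u ≤ toCatL v ↔ ∀ᶠ x in residual K, (u : K → ℝ) x ≤ (v : K → ℝ) x :=
  Germ.coe_le

theorem toCatL_eq_iff_eventually {u v : CatB K} :
    toCatL u = toCatL v ↔ ∀ᶠ x in residual K, (u : K → ℝ) x = (v : K → ℝ) x :=
  Subtype.ext_iff.trans Germ.coe_eq

theorem toCatL_surjective : Function.Surjective (toCatL (K := K)) := by
  rintro ⟨_, u, hu, rfl⟩
  exact ⟨⟨u, hu⟩, rfl⟩

theorem toCatL_add (u v : CatB K) : toCatL (u + v) = toCatL u + toCatL v := rfl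

theorem toCatL_smul (c : ℝ) (u : CatB K) : toCatL (c • u) = c • toCatL u := rfl

theorem toCatL_zero : toCatL (0 : CatB K) = 0 := rfl

theorem measurableSet_catAlg_of_isOpen {U : Set K} (hU : IsOpen U) :
    MeasurableSet[catAlg K] U :=
  (measurableSet_catAlg_iff K U).2 ⟨U, ∅, hU, IsMeagre.empty, (symmDiff_bot U).symm⟩

theorem borel_le_catAlg : borel K ≤ catAlg K :=
  MeasurableSpace.generateFrom_le fun _ hU => measurableSet_catAlg_of_isOpen hU

theorem measurableSet_catAlg_of_isMeagre {N : Set K} (hN : IsMeagre N) :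
    MeasurableSet[catAlg K] N :=
  (measurableSet_catAlg_iff K N).2 ⟨∅, N, isOpen_empty, hN, (bot_symmDiff N).symm⟩

/-- In a Baire space, a property that holds off a meagre set holds somewhere in each nonempty
open set. -/
theorem exists_mem_of_eventually_residual [BaireSpace K] {U : Set K} (hU : IsOpen U)
    (hne : U.Nonempty) {p : K → Prop} (hp : ∀ᶠ x in residual K, p x) : ∃ x ∈ U, p x :=
  (dense_of_mem_residual hp).inter_open_nonempty U hU hne

/-! ### Continuous functions below measurable ones -/

section

variable [CompactSpace K] [T2Space K]

theorem continuousMap_le_of_eventually_residual {f g : C(K, ℝ)}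
    (h : ∀ᶠ x in residual K, f x ≤ g x) : f ≤ g := by
  intro x
  by_contra! hx
  obtain ⟨y, hy, hy'⟩ := exists_mem_of_eventually_residual
    (isOpen_lt g.continuous f.continuous) ⟨x, hx⟩ h
  exact absurd hy' (not_le.2 hy)

/-- Below the indicator of a nonempty open set there is a nonzero nonnegative continuous
function. -/
theorem exists_continuousMap_le_indicator {U : Set K} (hU : IsOpen U) (hne : U.Nonempty)
    {ε : ℝ} (hε : 0 < ε) :
    ∃ h : C(K, ℝ), 0 < h ∧ ∀ x, h x ≤ U.indicator (fun _ => ε) x := by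
  obtain ⟨x, hx⟩ := hne
  obtain ⟨f, hf0, hf1, hf⟩ := exists_continuous_zero_one_of_isClosed hU.isClosed_compl
    (isClosed_singleton (x := x)) (by simpa using hx)
  have h0 : (0 : C(K, ℝ)) ≤ ε • f := fun y => by
    simpa using mul_nonneg hε.le (hf y).1
  refine ⟨ε • f, lt_of_le_of_ne h0 fun h => ?_, fun y => ?_⟩
  · have := DFunLike.congr_fun h x
    simp only [ContinuousMap.zero_apply, ContinuousMap.smul_apply, smul_eq_mul] at this
    rw [hf1 (mem_singleton x)] at this
    simp at this
    exact hε.ne this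
  · by_cases hy : y ∈ U
    · simp only [hy, indicator_of_mem, ContinuousMap.smul_apply, smul_eq_mul]
      exact mul_le_of_le_one_right hε.le (hf y).2
    · simp [hy, hf0 hy]

/-- The continuous functions are order dense in the classes of measurable functions. -/
theorem exists_continuousMap_pos_le {u : K → ℝ} (hu : Measurable[catAlg K] u)
    (hpos : ¬ ∀ᶠ x in residual K, u x ≤ 0) :
    ∃ h : C(K, ℝ), 0 < h ∧ ∀ᶠ x in residual K, h x ≤ max (u x) 0 := by
  -- The set where `u > 0` is a countable union of the sets where `u > 1/(n+1)`, so one of these is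
  -- nonmeagre; modulo a meagre set it is a nonempty open set.
  obtain ⟨n, hn⟩ : ∃ n : ℕ, ¬ ∀ᶠ x in residual K, u x ≤ 1 / ((n : ℝ) + 1) := by
    by_contra! H
    refine hpos ((eventually_countable_forall.2 H).mono fun x hx => ?_)
    exact ge_of_tendsto' tendsto_one_div_add_atTop_nhds_zero_nat hx
  set ε : ℝ := 1 / ((n : ℝ) + 1) with hεdef
  have hε : 0 < ε := by positivity
  have hA : MeasurableSet[catAlg K] {x | ε < u x} := hu measurableSet_Ioi
  obtain ⟨U, hU, hAU⟩ := BaireMeasurableSet.iff_residualEq_isOpen.1 hA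
  have hAU' := Filter.eventuallyEq_set.1 hAU
  have hne : U.Nonempty := by
    by_contra! hU0
    refine hn (hAU'.mono fun x hx => ?_)
    simpa [hU0] using hx
  obtain ⟨h, h0, hle⟩ := exists_continuousMap_le_indicator hU hne hε
  refine ⟨h, h0, hAU'.mono fun x hx => (hle x).trans ?_⟩
  by_cases hxU : x ∈ U
  · have : ε < u x := hx.2 hxU
    simp [hxU, this.le]
  · simp [hxU]

end

/-- The Archimedean property; it closes every argument in which a fixed `h > 0` can be added
indefinitely. -/
theorem nonpos_of_forall_nsmul_le {f g h : C(K, ℝ)} (H : ∀ n : ℕ, f + n • h ≤ g) : h ≤ 0 := by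
  intro x
  by_contra! hx
  obtain ⟨n, hn⟩ := exists_nat_gt ((g x - f x) / h x)
  have h1 : f x + n * h x ≤ g x := by simpa using H n x
  have hx' : 0 < h x := hx
  rw [div_lt_iff₀ hx'] at hn
  linarith

/-! ### Approximation of the elements of a Dedekind completion by continuous functions -/

namespace IsDedekindCompletion

variable [CompactSpace K] {E : Type*} [NormedAddCommGroup E] [Lattice E]
  [NormedSpace ℝ E] {ι : C(K, ℝ) →ₗᵢ[ℝ] E}


theorem map_le_map_iff (hι : IsDedekindCompletion ι) {f g : C(K, ℝ)} : ι f ≤ ι g ↔ f ≤ g := by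
  rw [← inf_eq_left, ← hι.map_inf, ι.injective.eq_iff, inf_eq_left]

theorem exists_le_map (hι : IsDedekindCompletion ι) (e : E) : ∃ g, e ≤ ι g := by
  obtain ⟨g, hg⟩ := hι.majorizing (e ⊔ 0) le_sup_right
  exact ⟨g, le_sup_left.trans hg⟩

variable [IsOrderedAddMonoid E]

theorem exists_map_le (hι : IsDedekindCompletion ι) (e : E) : ∃ g, ι g ≤ e := by
  obtain ⟨g, hg⟩ := hι.exists_le_map (-e)
  exact ⟨-g, by rw [map_neg]; exact neg_le.1 hg⟩

/-- If an upper bound `b` failed to dominate `e`, order density would give `ι h` with `0 < ι h ≤ e -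
e ⊓ b`. Whatever lies below `e` lies below `e ⊓ b`, so adding `h` keeps it below `e`, for ever. -/
theorem isLUB_map_le (hι : IsDedekindCompletion ι) (e : E) :
    IsLUB {a | ∃ f, ι f ≤ e ∧ a = ι f} e := by
  refine ⟨by rintro _ ⟨f, hf, rfl⟩; exact hf, fun b hb => ?_⟩
  have hb' : ∀ f, ι f ≤ e → ι f ≤ b := fun f hf => hb ⟨f, hf, rfl⟩
  by_contra hne
  have hd : 0 < e - e ⊓ b := sub_pos.2 (lt_of_le_of_ne inf_le_left fun h => hne (inf_eq_left.1 h))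
  obtain ⟨h, h0, hh⟩ := hι.order_dense _ hd
  obtain ⟨f, hf⟩ := hι.exists_map_le e
  obtain ⟨g, hg⟩ := hι.exists_le_map e
  have step : ∀ n : ℕ, ι (f + n • h) ≤ e := by
    intro n
    induction n with
    | zero => simpa using hf
    | succ n ih =>
      rw [succ_nsmul, ← add_assoc, map_add]
      calc ι (f + n • h) + ι h ≤ e ⊓ b + (e - e ⊓ b) := add_le_add (le_inf ih (hb' _ ih)) hh
        _ = e := by abel
  have : h ≤ 0 := nonpos_of_forall_nsmul_le fun n => hι.map_le_map_iff.1 ((step n).trans hg)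
  have := hι.map_le_map_iff.2 this
  rw [map_zero] at this
  exact absurd (h0.trans_le this) (lt_irrefl _)

theorem le_of_forall_map_le (hι : IsDedekindCompletion ι) {e b : E}
    (h : ∀ f, ι f ≤ e → ι f ≤ b) : e ≤ b :=
  (hι.isLUB_map_le e).2 (by rintro _ ⟨f, hf, rfl⟩; exact h f hf)

theorem le_of_forall_le_map (hι : IsDedekindCompletion ι) {e b : E}
    (h : ∀ f, e ≤ ι f → b ≤ ι f) : b ≤ e := by
  refine neg_le_neg_iff.1 (hι.le_of_forall_map_le fun f hf => ?_)
  rw [← neg_neg f, map_neg] at hf ⊢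
  exact neg_le_neg (h _ (neg_le_neg_iff.1 hf))

end IsDedekindCompletion

/-! ### The semicontinuous envelopes of an element of the Dedekind completion -/

section

variable [CompactSpace K] {E : Type*} [NormedAddCommGroup E] [Lattice E] [NormedSpace ℝ E]

/-- The pointwise supremum of the continuous functions below `e`. -/
def lowerEnvelope (ι : C(K, ℝ) →ₗᵢ[ℝ] E) (e : E) (x : K) : ℝ :=
  ⨆ f : {f : C(K, ℝ) // ι f ≤ e}, f.1 x

/-- The pointwise infimum of the continuous functions above `e`. -/
def upperEnvelope (ι : C(K, ℝ) →ₗᵢ[ℝ] E) (e : E) (x : K) : ℝ :=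
  ⨅ f : {f : C(K, ℝ) // e ≤ ι f}, f.1 x

variable {ι : C(K, ℝ) →ₗᵢ[ℝ] E}

theorem IsDedekindCompletion.le_lowerEnvelope (hι : IsDedekindCompletion ι) {e : E} {f : C(K, ℝ)} (hf : ι f ≤ e) (x : K) :
    f x ≤ lowerEnvelope ι e x := by
  obtain ⟨g, hg⟩ := hι.exists_le_map e
  refine le_ciSup (f := fun f : {f : C(K, ℝ) // ι f ≤ e} => f.1 x) ⟨g x, ?_⟩ ⟨f, hf⟩
  rintro _ ⟨k, rfl⟩
  exact hι.map_le_map_iff.1 (k.2.trans hg) x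

variable [IsOrderedAddMonoid E]

theorem upperEnvelope_eq_neg (e : E) (x : K) :
    upperEnvelope ι e x = -lowerEnvelope ι (-e) x := by
  have : Function.Surjective fun f : {f : C(K, ℝ) // e ≤ ι f} =>
      (⟨-f.1, by rw [map_neg]; exact neg_le_neg f.2⟩ : {f : C(K, ℝ) // ι f ≤ -e}) := by
    rintro ⟨f, hf⟩
    exact ⟨⟨-f, by rw [map_neg]; exact le_neg_of_le_neg hf⟩, by simp⟩
  rw [lowerEnvelope, ← this.iSup_comp, upperEnvelope, iInf, Real.sInf_def, neg_range]
  rfl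

namespace IsDedekindCompletion

variable (hι : IsDedekindCompletion ι)
include hι

theorem lowerEnvelope_le {e : E} {x : K} {c : ℝ} (h : ∀ f, ι f ≤ e → f x ≤ c) :
    lowerEnvelope ι e x ≤ c := by
  obtain ⟨f, hf⟩ := hι.exists_map_le e
  have : Nonempty {f : C(K, ℝ) // ι f ≤ e} := ⟨⟨f, hf⟩⟩
  exact ciSup_le fun f => h f.1 f.2

theorem exists_lt_of_lt_lowerEnvelope {e : E} {x : K} {c : ℝ} (h : c < lowerEnvelope ι e x) :
    ∃ f, ι f ≤ e ∧ c < f x := by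
  by_contra! H
  exact absurd h (not_lt.2 (hι.lowerEnvelope_le H))

theorem upperEnvelope_le {e : E} {f : C(K, ℝ)} (hf : e ≤ ι f) (x : K) :
    upperEnvelope ι e x ≤ f x := by
  rw [upperEnvelope_eq_neg, neg_le]
  exact hι.le_lowerEnvelope (f := -f) (by rw [map_neg]; exact neg_le_neg hf) x

theorem exists_lt_of_upperEnvelope_lt {e : E} {x : K} {c : ℝ} (h : upperEnvelope ι e x < c) :
    ∃ f, e ≤ ι f ∧ f x < c := by
  rw [upperEnvelope_eq_neg] at h
  obtain ⟨f, hf, hx⟩ := hι.exists_lt_of_lt_lowerEnvelope (neg_lt.1 h)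
  exact ⟨-f, by rw [map_neg]; exact le_neg_of_le_neg hf, by simpa using neg_lt.1 hx⟩

theorem lowerEnvelope_le_upperEnvelope (e : E) (x : K) :
    lowerEnvelope ι e x ≤ upperEnvelope ι e x := by
  by_contra! h
  obtain ⟨f, hf, hx⟩ := hι.exists_lt_of_lt_lowerEnvelope h
  obtain ⟨g, hg, hx'⟩ := hι.exists_lt_of_upperEnvelope_lt hx
  exact absurd (hι.map_le_map_iff.1 (hf.trans hg) x) (not_le.2 hx')

theorem measurable_lowerEnvelope (e : E) : Measurable[catAlg K] (lowerEnvelope ι e) := by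
  let _ := catAlg K
  refine measurable_of_Ioi fun c => measurableSet_catAlg_of_isOpen ?_
  have : lowerEnvelope ι e ⁻¹' Ioi c = ⋃ f : {f : C(K, ℝ) // ι f ≤ e}, {x | c < f.1 x} := by
    ext x
    simp only [mem_preimage, mem_Ioi, mem_iUnion]
    constructor
    · intro h
      obtain ⟨f, hf, hx⟩ := hι.exists_lt_of_lt_lowerEnvelope h
      exact ⟨⟨f, hf⟩, hx⟩
    · rintro ⟨f, hx⟩
      exact lt_of_lt_of_le hx (hι.le_lowerEnvelope f.2 x)
  rw [this]
  exact isOpen_iUnion fun f => isOpen_lt continuous_const f.1.continuous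

/-- The lower envelope as a bounded measurable function. -/
def lowerEnvelopeCatB (e : E) : CatB K :=
  ⟨lowerEnvelope ι e, hι.measurable_lowerEnvelope e, by
    obtain ⟨f, hf⟩ := hι.exists_map_le e
    obtain ⟨g, hg⟩ := hι.exists_le_map e
    refine ⟨‖f‖ + ‖g‖, fun x => ?_⟩
    have h1 := abs_le.1 (f.norm_coe_le_norm x)
    have h2 := abs_le.1 (g.norm_coe_le_norm x)
    have h3 := hι.le_lowerEnvelope hf x
    have h4 := (hι.lowerEnvelope_le_upperEnvelope e x).trans (hι.upperEnvelope_le hg x)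
    rw [abs_le]
    constructor <;> linarith [norm_nonneg f, norm_nonneg g, h1.1, h2.2]⟩

theorem lowerEnvelope_add_le (a b : E) (x : K) :
    lowerEnvelope ι a x + lowerEnvelope ι b x ≤ lowerEnvelope ι (a + b) x := by
  by_contra! h
  obtain ⟨f, hf, hx⟩ := hι.exists_lt_of_lt_lowerEnvelope (sub_lt_iff_lt_add.2 h)
  obtain ⟨g, hg, hx'⟩ := hι.exists_lt_of_lt_lowerEnvelope (sub_lt_comm.1 hx)
  have := hι.le_lowerEnvelope (f := f + g) ((map_add ι f g).trans_le (add_le_add hf hg)) x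
  rw [ContinuousMap.add_apply] at this
  linarith

theorem upperEnvelope_add_le (a b : E) (x : K) :
    upperEnvelope ι (a + b) x ≤ upperEnvelope ι a x + upperEnvelope ι b x := by
  have := hι.lowerEnvelope_add_le (-a) (-b) x
  rw [← neg_add] at this
  simp only [upperEnvelope_eq_neg]
  linarith

theorem lowerEnvelope_map (f : C(K, ℝ)) (x : K) : lowerEnvelope ι (ι f) x = f x :=
  le_antisymm (hι.lowerEnvelope_le fun _ hg => hι.map_le_map_iff.1 hg x)
    (hι.le_lowerEnvelope le_rfl x)

theorem lowerEnvelope_mono {a b : E} (h : a ≤ b) (x : K) :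
    lowerEnvelope ι a x ≤ lowerEnvelope ι b x :=
  hι.lowerEnvelope_le fun _ hf => hι.le_lowerEnvelope (hf.trans h) x

theorem lowerEnvelope_smul_of_pos [IsOrderedModule ℝ E] {c : ℝ} (hc : 0 < c) (a : E) (x : K) :
    lowerEnvelope ι (c • a) x = c * lowerEnvelope ι a x := by
  have key : ∀ {c : ℝ}, 0 < c → ∀ a : E,
      c * lowerEnvelope ι a x ≤ lowerEnvelope ι (c • a) x := fun {c} hc a => by
    rw [mul_comm, ← le_div_iff₀ hc]
    refine hι.lowerEnvelope_le fun f hf => ?_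
    rw [le_div_iff₀ hc, mul_comm]
    exact hι.le_lowerEnvelope (f := c • f)
      (by rw [map_smul]; exact smul_le_smul_of_nonneg_left hf hc.le) x
  refine le_antisymm ?_ (key hc a)
  have := key (inv_pos.2 hc) (c • a)
  rwa [inv_smul_smul₀ hc.ne', inv_mul_le_iff₀ hc] at this

variable [T2Space K]

/-- A continuous `h > 0` below the gap satisfies `f + h ≤ g` off a meagre set, hence everywhere,
whenever `ι f ≤ e ≤ ι g`. So `ι f ≤ e` implies `ι (f + h) ≤ e`, and iteration is absurd. -/
theorem upperEnvelope_eventuallyEq (e : E) :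
    ∀ᶠ x in residual K, upperEnvelope ι e x = lowerEnvelope ι e x := by
  by_contra H
  have hm : Measurable[catAlg K] fun x => upperEnvelope ι e x - lowerEnvelope ι e x := by
    let _ := catAlg K
    simp only [upperEnvelope_eq_neg]
    exact (hι.measurable_lowerEnvelope (-e)).neg.sub (hι.measurable_lowerEnvelope e)
  obtain ⟨h, h0, hle⟩ := exists_continuousMap_pos_le hm fun h => H (h.mono fun x hx =>
    le_antisymm (sub_nonpos.1 hx) (hι.lowerEnvelope_le_upperEnvelope e x))
  have key : ∀ f, ι f ≤ e → ι (f + h) ≤ e := fun f hf => by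
    refine hι.le_of_forall_le_map fun g hg => hι.map_le_map_iff.2 ?_
    refine continuousMap_le_of_eventually_residual (hle.mono fun x hx => ?_)
    have h1 := hι.le_lowerEnvelope hf x
    have h2 := hι.upperEnvelope_le hg x
    have h3 := hι.lowerEnvelope_le_upperEnvelope e x
    rw [max_eq_left (sub_nonneg.2 h3)] at hx
    rw [ContinuousMap.add_apply]
    linarith
  obtain ⟨f, hf⟩ := hι.exists_map_le e
  obtain ⟨g, hg⟩ := hι.exists_le_map e
  refine absurd (h0.trans_le (nonpos_of_forall_nsmul_le (f := f) (g := g) fun n => ?_))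
    (lt_irrefl _)
  refine hι.map_le_map_iff.1 (le_trans ?_ hg)
  induction n with
  | zero => simpa using hf
  | succ n ih =>
    rw [succ_nsmul, ← add_assoc]
    exact key _ ih

theorem le_of_eventually_lowerEnvelope_le {a b : E}
    (h : ∀ᶠ x in residual K, lowerEnvelope ι a x ≤ lowerEnvelope ι b x) : a ≤ b := by
  refine hι.le_of_forall_map_le fun f hf => hι.le_of_forall_le_map fun g hg => ?_
  refine hι.map_le_map_iff.2 (continuousMap_le_of_eventually_residual (h.mono fun x hx => ?_))
  exact (hι.le_lowerEnvelope hf x).trans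
    (hx.trans ((hι.lowerEnvelope_le_upperEnvelope b x).trans (hι.upperEnvelope_le hg x)))

theorem lowerEnvelope_add (a b : E) : ∀ᶠ x in residual K,
    lowerEnvelope ι (a + b) x = lowerEnvelope ι a x + lowerEnvelope ι b x := by
  filter_upwards [hι.upperEnvelope_eventuallyEq a, hι.upperEnvelope_eventuallyEq b,
    hι.upperEnvelope_eventuallyEq (a + b)] with x h1 h2 h3
  have h4 := hι.lowerEnvelope_add_le a b x
  have h5 := hι.upperEnvelope_add_le a b x
  rw [h1, h2, h3] at h5
  exact le_antisymm h5 h4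

theorem lowerEnvelope_neg (a : E) : ∀ᶠ x in residual K,
    lowerEnvelope ι (-a) x = -lowerEnvelope ι a x :=
  (hι.upperEnvelope_eventuallyEq a).mono fun x hx => by
    rw [← hx, upperEnvelope_eq_neg, neg_neg]

variable [IsOrderedModule ℝ E]

theorem lowerEnvelope_smul (c : ℝ) (a : E) : ∀ᶠ x in residual K,
    lowerEnvelope ι (c • a) x = c * lowerEnvelope ι a x := by
  rcases lt_trichotomy c 0 with hc | rfl | hc
  · filter_upwards [hι.lowerEnvelope_neg (-(c • a))] with x hx
    rw [neg_neg, ← neg_smul, hι.lowerEnvelope_smul_of_pos (neg_pos.2 hc)] at hx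
    rw [hx]
    ring
  · refine Eventually.of_forall fun x => ?_
    have := hι.lowerEnvelope_map 0 x
    simpa using this
  · exact Eventually.of_forall (hι.lowerEnvelope_smul_of_pos hc a)

/-- The canonical linear map from the Dedekind completion to the classes of measurable
functions. -/
def toCatLLinear : E →ₗ[ℝ] CatL K where
  toFun e := toCatL (hι.lowerEnvelopeCatB e)
  map_add' a b := by
    rw [← toCatL_add]
    exact toCatL_eq_iff_eventually.2 (hι.lowerEnvelope_add a b)
  map_smul' c a := by
    rw [RingHom.id_apply, ← toCatL_smul]
    exact toCatL_eq_iff_eventually.2 (hι.lowerEnvelope_smul c a)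

theorem toCatLLinear_le_iff {a b : E} :
    hι.toCatLLinear a ≤ hι.toCatLLinear b ↔ a ≤ b := by
  refine ⟨fun h => ?_, fun h => ?_⟩
  · exact hι.le_of_eventually_lowerEnvelope_le (toCatL_le_iff_eventually.1 h)
  · exact toCatL_le_iff_eventually.2 (Eventually.of_forall (hι.lowerEnvelope_mono h))

theorem toCatLLinear_map (f : C(K, ℝ)) : hι.toCatLLinear (ι f) = toCatL (ofCont f) :=
  toCatL_eq_iff_eventually.2 (Eventually.of_forall (hι.lowerEnvelope_map f))

/-- The preimage is the supremum in `E` of the continuous functions that lie below `v` off a meagre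
set. Its two envelopes enclose `v` off a meagre set. -/
theorem toCatLLinear_surjective : Function.Surjective hι.toCatLLinear := by
  intro w
  obtain ⟨v, rfl⟩ := toCatL_surjective w
  obtain ⟨M, hM⟩ := v.2.2
  have hvm : Measurable[catAlg K] (v : K → ℝ) := v.2.1
  let A : Set C(K, ℝ) := {f | ∀ᶠ x in residual K, f x ≤ (v : K → ℝ) x}
  have hAM : ∀ f ∈ A, f ≤ ContinuousMap.const K M := fun f hf =>
    continuousMap_le_of_eventually_residual
      (Eventually.mono (show ∀ᶠ x in residual K, f x ≤ (v : K → ℝ) x from hf)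
        fun x hx => hx.trans (abs_le.1 (hM x)).2)
  have hA0 : -ContinuousMap.const K M ∈ A :=
    mem_ofPred_eq ▸ Eventually.of_forall fun x => (abs_le.1 (hM x)).1
  obtain ⟨e, he⟩ := hι.dedekind_complete_above (ι '' A) ⟨_, mem_image_of_mem _ hA0⟩
    ⟨ι (ContinuousMap.const K M), by
      rintro _ ⟨f, hf, rfl⟩
      exact hι.map_le_map_iff.2 (hAM f hf)⟩
  have heA : ∀ f ∈ A, ι f ≤ e := fun f hf => he.1 (mem_image_of_mem _ hf)
  have hem := hι.measurable_lowerEnvelope e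
  have hem' := hι.measurable_lowerEnvelope (-e)
  refine ⟨e, toCatL_eq_iff_eventually.2 ?_⟩
  have h1 : ∀ᶠ x in residual K, (v : K → ℝ) x - lowerEnvelope ι e x ≤ 0 := by
    by_contra H
    have hm : Measurable[catAlg K] fun x => (v : K → ℝ) x - lowerEnvelope ι e x := by
      let _ := catAlg K
      exact hvm.sub hem
    obtain ⟨h, h0, hle⟩ := exists_continuousMap_pos_le hm H
    have key : ∀ f ∈ A, f + h ∈ A := fun f hf => by
      filter_upwards [hf, hle] with x hx hx'
      have := hι.le_lowerEnvelope (heA f hf) x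
      rw [ContinuousMap.add_apply]
      rcases le_total ((v : K → ℝ) x - lowerEnvelope ι e x) 0 with h | h
      · rw [max_eq_right h] at hx'; linarith
      · rw [max_eq_left h] at hx'; linarith
    refine absurd (h0.trans_le (nonpos_of_forall_nsmul_le (f := -ContinuousMap.const K M)
      fun n => hAM _ ?_)) (lt_irrefl _)
    induction n with
    | zero => simpa using hA0
    | succ n ih => rw [succ_nsmul, ← add_assoc]; exact key _ ih
  have h2 : ∀ᶠ x in residual K, upperEnvelope ι e x - (v : K → ℝ) x ≤ 0 := by
    by_contra H
    have hm : Measurable[catAlg K] fun x => upperEnvelope ι e x - (v : K → ℝ) x := by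
      let _ := catAlg K
      simp only [upperEnvelope_eq_neg]
      exact hem'.neg.sub hvm
    obtain ⟨h, h0, hle⟩ := exists_continuousMap_pos_le hm H
    -- An essential majorant `g` of `v` dominates all of `A`, hence `e`, hence the upper envelope.
    -- As `h` is below the gap between that envelope and `v`, subtracting `h` leaves a majorant of
    -- `v`.
    have key : ∀ g : C(K, ℝ), (∀ᶠ x in residual K, (v : K → ℝ) x ≤ g x) →
        ∀ᶠ x in residual K, (v : K → ℝ) x ≤ (g - h) x := fun g hg => by
      have heg : e ≤ ι g := he.2 (by
        rintro _ ⟨f, hf, rfl⟩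
        exact hι.map_le_map_iff.2 (continuousMap_le_of_eventually_residual
          (by filter_upwards [hf, hg] with x h1 h2 using h1.trans h2)))
      filter_upwards [hg, hle] with x hx hx'
      have := hι.upperEnvelope_le heg x
      rw [ContinuousMap.sub_apply]
      rcases le_total (upperEnvelope ι e x - (v : K → ℝ) x) 0 with h | h
      · rw [max_eq_right h] at hx'; linarith
      · rw [max_eq_left h] at hx'; linarith
    have step : ∀ n : ℕ, ∀ᶠ x in residual K,
        (v : K → ℝ) x ≤ (ContinuousMap.const K M - n • h) x := by
      intro n
      induction n with
      | zero => exact Eventually.of_forall fun x => by simpa using (abs_le.1 (hM x)).2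
      | succ n ih => rw [succ_nsmul, ← sub_sub]; exact key _ ih
    refine absurd (h0.trans_le (nonpos_of_forall_nsmul_le (f := -ContinuousMap.const K M)
      (g := ContinuousMap.const K M) fun n => ?_)) (lt_irrefl _)
    refine continuousMap_le_of_eventually_residual ((step n).mono fun x hx => ?_)
    have h3 := (abs_le.1 (hM x)).1
    simp only [ContinuousMap.sub_apply, ContinuousMap.add_apply, ContinuousMap.neg_apply,
      ContinuousMap.const_apply] at hx ⊢
    linarith
  filter_upwards [h1, h2] with x hx hx'
  have := hι.lowerEnvelope_le_upperEnvelope e x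
  change lowerEnvelope ι e x = _
  linarith

/-- The canonical identification of the Dedekind completion with the classes of measurable
functions. -/
def catLEquiv : E ≃ₗ[ℝ] CatL K :=
  LinearEquiv.ofBijective hι.toCatLLinear
    ⟨fun _ _ h => le_antisymm (hι.toCatLLinear_le_iff.1 h.le) (hι.toCatLLinear_le_iff.1 h.ge),
      hι.toCatLLinear_surjective⟩

theorem isIdentification_catLEquiv : IsIdentification ι hι.catLEquiv :=
  ⟨fun _ _ => hι.toCatLLinear_le_iff, hι.toCatLLinear_map⟩

/-- An order isomorphism preserves suprema, and each `e` is the supremum of the continuous functions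
below it. -/
theorem eq_catLEquiv {T : E ≃ₗ[ℝ] CatL K} (hT : IsIdentification ι T) : T = hι.catLEquiv := by
  have key : ∀ {S : E ≃ₗ[ℝ] CatL K}, IsIdentification ι S → ∀ e : E,
      IsLUB {a | ∃ f, ι f ≤ e ∧ a = toCatL (ofCont f)} (S e) := fun {S} hS e => by
    refine ⟨?_, fun w hw => ?_⟩
    · rintro _ ⟨f, hf, rfl⟩
      rw [← hS.2]
      exact (hS.1 _ _).2 hf
    · rw [← S.apply_symm_apply w, hS.1]
      refine hι.le_of_forall_map_le fun f hf => ?_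
      rw [← hS.1, S.apply_symm_apply, hS.2]
      exact hw ⟨f, hf, rfl⟩
  ext1 e
  exact (key hT e).unique (key hι.isIdentification_catLEquiv e)

end IsDedekindCompletion

end

/-! ### The measure of a bounded functional -/

attribute [local instance] catAlg

/-- The indicator function of a set with the property of Baire. -/
def indicatorCatB (A : Set K) (hA : MeasurableSet A) : CatB K :=
  ⟨A.indicator 1, measurable_one.indicator hA, 1, fun x => by
    by_cases h : x ∈ A <;> simp [h]⟩

/-- A simple function as a bounded measurable function. -/
def simpleCatB (s : SimpleFunc K ℝ) : CatB K :=
  ⟨s, s.measurable, ∑ y ∈ s.range, |y|, fun x =>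
    Finset.single_le_sum (f := fun y => |y|) (fun y _ => abs_nonneg y) (s.mem_range_self x)⟩

theorem simpleCatB_eq_sum (s : SimpleFunc K ℝ) :
    simpleCatB s = ∑ y ∈ s.range, y • indicatorCatB (s ⁻¹' {y}) (s.measurableSet_fiber y) := by
  ext x
  have h : ((∑ y ∈ s.range, y • indicatorCatB (s ⁻¹' {y}) (s.measurableSet_fiber y) : CatB K) :
      K → ℝ) x = ∑ y ∈ s.range, y * (s ⁻¹' {y}).indicator 1 x := by
    simp [indicatorCatB, Finset.sum_apply]
  rw [h, Finset.sum_eq_single (s x)]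
  · simp [simpleCatB]
  · intro y _ hy
    simp [indicator, hy.symm]
  · intro h
    exact absurd (s.mem_range_self x) h

theorem indicatorCatB_union {A B : Set K} (hA : MeasurableSet A) (hB : MeasurableSet B)
    (h : Disjoint A B) :
    indicatorCatB (A ∪ B) (hA.union hB) = indicatorCatB A hA + indicatorCatB B hB :=
  Subtype.ext (indicator_union_of_disjoint h 1)

theorem toCatL_indicatorCatB_of_isMeagre {N : Set K} (hN : IsMeagre N) (hN' : MeasurableSet N) :
    toCatL (indicatorCatB N hN') = 0 := by
  rw [← toCatL_zero, toCatL_eq_iff_eventually]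
  have : ∀ᶠ x in residual K, x ∈ Nᶜ := hN
  exact this.mono fun x hx => indicator_of_notMem hx 1

section

variable {E : Type*} [NormedAddCommGroup E] [NormedSpace ℝ E]

/-- A functional on the Dedekind completion as a functional on bounded measurable functions. -/
def functionalCatB (T : E ≃ₗ[ℝ] CatL K) (φ : StrongDual ℝ E) : CatB K →ₗ[ℝ] ℝ where
  toFun u := φ (T.symm (toCatL u))
  map_add' u v := by rw [toCatL_add, map_add, map_add]
  map_smul' c u := by rw [toCatL_smul, map_smul, map_smul, RingHom.id_apply]

theorem functionalCatB_apply (T : E ≃ₗ[ℝ] CatL K) (φ : StrongDual ℝ E) (u : CatB K) :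
    functionalCatB T φ u = φ (T.symm (toCatL u)) := rfl

variable {T : E ≃ₗ[ℝ] CatL K} {φ : StrongDual ℝ E} {μ : CatFam K}

/-- The indicator is itself simple, so it serves as its own approximant for every tolerance. This
forces uniqueness of `μ`. -/
theorem Represents.toFun_eq (hμ : Represents T μ φ) {A : Set K} (hA : MeasurableSet A) :
    μ.toFun A = functionalCatB T φ (indicatorCatB A hA) := by
  classical
  let s : SimpleFunc K ℝ := SimpleFunc.piecewise A hA (SimpleFunc.const K 1) (SimpleFunc.const K 0)
  have hs : ∀ x, s x = A.indicator 1 x := fun x => by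
    by_cases h : x ∈ A <;> simp [s, h]
  have h1 : s ⁻¹' {1} = A := by
    ext x
    by_cases h : x ∈ A <;> simp [hs, h]
  have hsI : μ.simpleIntegral s = μ.toFun A := by
    -- Only an inclusion, since `A` may be empty or all of `K`; a missing value has empty fibre and
    -- contributes zero.
    have hsub : s.range ⊆ {0, 1} := fun y hy => by
      obtain ⟨x, rfl⟩ := SimpleFunc.mem_range.1 hy
      by_cases h : x ∈ A <;> simp [hs, h]
    rw [CatFam.simpleIntegral, Finset.sum_subset hsub]
    · simp [h1]
    · intro y _ hy
      have : s ⁻¹' {y} = ∅ := by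
        rwa [SimpleFunc.mem_range, ← preimage_singleton_eq_empty] at hy
      rw [this, μ.meagre ∅ IsMeagre.empty, mul_zero]
  refine eq_of_abs_sub_le_all fun ε hε => ?_
  obtain ⟨δ, hδ, H⟩ := hμ (indicatorCatB A hA) ε hε
  rw [← hsI]
  exact H s fun x => by rw [hs]; simpa [indicatorCatB] using hδ.le

variable [CompactSpace K] [Lattice E] {ι : C(K, ℝ) →ₗᵢ[ℝ] E} [IsOrderedAddMonoid E]
  [HasSolidNorm E]

/-- The element of `E` lies between `±ι c`, so solidity of the norm and isometry of `ι` bound its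
norm by `c`. -/
theorem IsIdentification.abs_functionalCatB_le (hT : IsIdentification ι T) {u : CatB K} {c : ℝ}
    (hc : 0 ≤ c) (hu : ∀ x, |(u : K → ℝ) x| ≤ c) : |functionalCatB T φ u| ≤ ‖φ‖ * c := by
  have h1 : T.symm (toCatL u) ≤ ι (ContinuousMap.const K c) := by
    rw [← hT.1, T.apply_symm_apply, hT.2, toCatL_le_iff_eventually]
    exact Eventually.of_forall fun x => (abs_le.1 (hu x)).2
  have h2 : ι (-ContinuousMap.const K c) ≤ T.symm (toCatL u) := by
    rw [← hT.1, T.apply_symm_apply, hT.2, toCatL_le_iff_eventually]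
    exact Eventually.of_forall fun x => (abs_le.1 (hu x)).1
  rw [map_neg] at h2
  have h3 : ‖T.symm (toCatL u)‖ ≤ c := by
    refine (HasSolidNorm.solid (y := ι (ContinuousMap.const K c)) ?_).trans ?_
    · exact (abs_le'.2 ⟨h1, neg_le.1 h2⟩).trans (le_abs_self _)
    · rw [ι.norm_map]
      exact (ContinuousMap.norm_le _ hc).2 fun x => by simp [abs_of_nonneg hc]
  exact (φ.le_opNorm _).trans (mul_le_mul_of_nonneg_left h3 (norm_nonneg φ))

open Classical in
/-- The finitely additive measure of a functional on the Dedekind completion. -/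
def IsIdentification.catFam (hT : IsIdentification ι T) (φ : StrongDual ℝ E) : CatFam K where
  toFun A := if hA : MeasurableSet A then functionalCatB T φ (indicatorCatB A hA) else 0
  not_measurable A hA := dif_neg hA
  additive A B hA hB h := by
    rw [dif_pos hA, dif_pos hB, dif_pos (hA.union hB), indicatorCatB_union hA hB h, map_add]
  bounded := ⟨‖φ‖ * 1, fun A hA => by
    rw [dif_pos hA]
    exact hT.abs_functionalCatB_le zero_le_one fun x => by
      by_cases h : x ∈ A <;> simp [indicatorCatB, h]⟩
  meagre N hN := by
    have hN' := measurableSet_catAlg_of_isMeagre hN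
    rw [dif_pos hN', functionalCatB_apply, toCatL_indicatorCatB_of_isMeagre hN, map_zero, map_zero]

theorem IsIdentification.represents_catFam (hT : IsIdentification ι T) (φ : StrongDual ℝ E) :
    Represents T (hT.catFam φ) φ := by
  intro u ε hε
  refine ⟨ε / (‖φ‖ + 1), by positivity, fun s hs => ?_⟩
  have h : (hT.catFam φ).simpleIntegral s = functionalCatB T φ (simpleCatB s) := by
    rw [simpleCatB_eq_sum, map_sum, CatFam.simpleIntegral]
    refine Finset.sum_congr rfl fun y _ => ?_
    rw [map_smul, smul_eq_mul]
    congr 1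
    exact dif_pos (s.measurableSet_fiber y)
  rw [h, ← functionalCatB_apply, ← map_sub]
  refine (hT.abs_functionalCatB_le (c := ε / (‖φ‖ + 1)) (by positivity) hs).trans ?_
  rw [mul_div_assoc', div_le_iff₀ (by positivity)]
  nlinarith [norm_nonneg φ]

theorem IsIdentification.existsUnique_represents (hT : IsIdentification ι T)
    (φ : StrongDual ℝ E) : ∃! μ : CatFam K, Represents T μ φ := by
  refine ⟨hT.catFam φ, hT.represents_catFam φ, fun μ hμ => CatFam.ext (funext fun A => ?_)⟩
  by_cases hA : MeasurableSet A
  · rw [hμ.toFun_eq hA, (hT.represents_catFam φ).toFun_eq hA]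
  · rw [μ.not_measurable A hA, (hT.catFam φ).not_measurable A hA]

end

/-! ### Countably additive case: Hahn decomposition and total variation -/

namespace CatFam

variable {μ : CatFam K}

theorem toFun_inter_add_diff (μ : CatFam K) {A B : Set K} (hA : MeasurableSet A)
    (hB : MeasurableSet B) : μ.toFun (A ∩ B) + μ.toFun (A \ B) = μ.toFun A := by
  rw [← μ.additive _ _ (hA.inter hB) (hA.diff hB) disjoint_sdiff_inter.symm, inter_union_sdiff]

/-- A countably additive element of `CatFam K` as a signed measure. -/
def toSignedMeasure (h : μ.CountablyAdditive) : SignedMeasure K where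
  measureOf' := μ.toFun
  empty' := μ.meagre ∅ IsMeagre.empty
  not_measurable' _ hA := μ.not_measurable _ hA
  m_iUnion' A hA hd := h A hA hd

theorem toSignedMeasure_apply (h : μ.CountablyAdditive) (A : Set K) :
    toSignedMeasure h A = μ.toFun A := rfl

/-- The Hahn decomposition, with the total variation expressed through it. -/
theorem exists_hahn (h : μ.CountablyAdditive) : ∃ P : Set K, MeasurableSet P ∧
    (∀ A, MeasurableSet A → 0 ≤ μ.toFun (A ∩ P)) ∧ (∀ A, MeasurableSet A → μ.toFun (A \ P) ≤ 0) ∧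
    ∀ A, MeasurableSet A → (toSignedMeasure h).totalVariation.real A =
      μ.toFun (A ∩ P) - μ.toFun (A \ P) := by
  obtain ⟨P, hP, h0, h1, hpos, hneg⟩ := (toSignedMeasure h).toJordanDecomposition_spec
  refine ⟨P, hP, fun A hA => ?_, fun A hA => ?_, fun A hA => ?_⟩
  · have := SignedMeasure.toMeasureOfZeroLE_real_apply _ h0 hP hA
    rw [inter_comm, ← toSignedMeasure_apply h, ← this]
    exact measureReal_nonneg
  · have := SignedMeasure.toMeasureOfLEZero_real_apply _ h1 hP.compl hA
    rw [sdiff_eq, inter_comm, ← toSignedMeasure_apply h, ← neg_nonneg, ← this]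
    exact measureReal_nonneg
  · rw [SignedMeasure.totalVariation, hpos, hneg, measureReal_add_apply,
      SignedMeasure.toMeasureOfZeroLE_real_apply _ h0 hP hA,
      SignedMeasure.toMeasureOfLEZero_real_apply _ h1 hP.compl hA, sdiff_eq, inter_comm A,
      inter_comm A, toSignedMeasure_apply, toSignedMeasure_apply, sub_eq_add_neg]

theorem abs_toFun_le (h : μ.CountablyAdditive) {A : Set K} (hA : MeasurableSet A) :
    |μ.toFun A| ≤ (toSignedMeasure h).totalVariation.real A := by
  obtain ⟨P, hP, h0, h1, h2⟩ := exists_hahn h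
  rw [h2 A hA, ← μ.toFun_inter_add_diff hA hP, abs_le]
  constructor <;> linarith [h0 A hA, h1 A hA]

theorem totalVariation_isMeagre (h : μ.CountablyAdditive) {N : Set K} (hN : IsMeagre N) :
    (toSignedMeasure h).totalVariation.real N = 0 := by
  obtain ⟨P, hP, h0, h1, h2⟩ := exists_hahn h
  rw [h2 N (measurableSet_catAlg_of_isMeagre hN), μ.meagre _ (hN.mono inter_subset_left),
    μ.meagre _ (hN.mono sdiff_subset), sub_zero]

theorem absVal_eq (h : μ.CountablyAdditive) {A : Set K} (hA : MeasurableSet A) :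
    μ.absVal A = (toSignedMeasure h).totalVariation.real A := by
  obtain ⟨P, hP, h0, h1, h2⟩ := exists_hahn h
  refine IsLUB.csSup_eq (IsGreatest.isLUB ⟨⟨A ∩ P, hA.inter hP, inter_subset_left, ?_⟩, ?_⟩)
    ⟨_, ∅, MeasurableSet.empty, empty_subset _, rfl⟩
  · rw [h2 A hA, sdiff_self_inter]
  · rintro _ ⟨B, hB, hBA, rfl⟩
    have h3 := le_of_abs_le (abs_toFun_le h hB)
    have h4 := neg_le_of_abs_le (abs_toFun_le h (hA.diff hB))
    have h5 := measureReal_sdiff_add_inter (μ := (toSignedMeasure h).totalVariation) (s := A) hB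
    rw [inter_eq_self_of_subset_right hBA] at h5
    linarith

end CatFam

/-! ### From order continuity to regularity -/

section

/-- As `φ` need not be positive, `|φ d|` may grow again as `d` decreases, while the definition
controls only an infimum. If smallness never persisted, the `d` with `|φ d| ≥ ε` would be cofinal in
`D`, hence directed with infimum `0`, a contradiction. -/
theorem OrderContinuous.exists_forall_le_abs_lt {E : Type*} [NormedAddCommGroup E] [Lattice E]
    [NormedSpace ℝ E] {φ : StrongDual ℝ E} (hφ : OrderContinuous φ) {D : Set E}
    (hne : D.Nonempty) (hD : DirectedOn (fun x y => y ≤ x) D) (h0 : IsGLB D 0) {ε : ℝ}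
    (hε : 0 < ε) : ∃ d ∈ D, ∀ d' ∈ D, d' ≤ d → |φ d'| < ε := by
  by_contra! H
  let D' : Set E := {d | d ∈ D ∧ ε ≤ |φ d|}
  have hcof : ∀ d ∈ D, ∃ d' ∈ D', d' ≤ d := fun d hd => by
    obtain ⟨d', h1, h2, h3⟩ := H d hd
    exact ⟨d', ⟨h1, h3⟩, h2⟩
  have hglb : IsGLB D' 0 := ⟨fun d hd => h0.1 hd.1, fun b hb => h0.2 fun d hd => by
    obtain ⟨d', h1, h2⟩ := hcof d hd
    exact (hb h1).trans h2⟩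
  have hne' : D'.Nonempty := by
    obtain ⟨d, hd⟩ := hne
    obtain ⟨d', hd', _⟩ := hcof d hd
    exact ⟨d', hd'⟩
  have hdir : DirectedOn (fun x y => y ≤ x) D' := fun x hx y hy => by
    obtain ⟨z, hz, h1, h2⟩ := hD x hx.1 y hy.1
    obtain ⟨z', hz', h3⟩ := hcof z hz
    exact ⟨z', hz', h3.trans h1, h3.trans h2⟩
  refine absurd ((hφ D' hne' hdir hglb).2 ?_) (not_le.2 hε)
  rintro _ ⟨d, hd, rfl⟩
  exact hd.2

variable [CompactSpace K] {E : Type*} [NormedAddCommGroup E] [Lattice E] [NormedSpace ℝ E]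
  {ι : C(K, ℝ) →ₗᵢ[ℝ] E} {T : E ≃ₗ[ℝ] CatL K} {φ : StrongDual ℝ E} {μ : CatFam K}

theorem IsIdentification.symm_le_symm_iff (hT : IsIdentification ι T) {u v : CatB K} :
    T.symm (toCatL u) ≤ T.symm (toCatL v) ↔
      ∀ᶠ x in residual K, (u : K → ℝ) x ≤ (v : K → ℝ) x := by
  rw [← hT.1, T.apply_symm_apply, T.apply_symm_apply, toCatL_le_iff_eventually]

/-- An order continuous functional is small on small sets of a downward directed family of
measurable sets with meagre essential intersection. -/
theorem OrderContinuous.exists_abs_toFun_lt (hφ : OrderContinuous φ) (hT : IsIdentification ι T)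
    (hμ : Represents T μ φ) {S : Set (Set K)} (hS : ∀ A ∈ S, MeasurableSet A) (hne : S.Nonempty)
    (hdir : DirectedOn (fun A B => B ⊆ A) S)
    (h0 : ∀ u : CatB K, (∀ A ∈ S, ∀ᶠ x in residual K, (u : K → ℝ) x ≤ A.indicator 1 x) →
      ∀ᶠ x in residual K, (u : K → ℝ) x ≤ 0) {ε : ℝ} (hε : 0 < ε) :
    ∃ A ∈ S, ∀ B ∈ S, B ⊆ A → |μ.toFun B| < ε := by
  let F : S → E := fun A => T.symm (toCatL (indicatorCatB A.1 (hS A.1 A.2)))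
  have hF : ∀ A B : S, B.1 ⊆ A.1 → F B ≤ F A := fun A B h => hT.symm_le_symm_iff.2
    (Eventually.of_forall fun x => indicator_le_indicator_of_subset h (fun _ => zero_le_one) x)
  obtain ⟨_, ⟨A, rfl⟩, hA⟩ := hφ.exists_forall_le_abs_lt (D := range F)
    (by obtain ⟨A, hA⟩ := hne; exact ⟨_, ⟨A, hA⟩, rfl⟩)
    (by
      rintro _ ⟨A, rfl⟩ _ ⟨B, rfl⟩
      obtain ⟨C, hC, h1, h2⟩ := hdir A.1 A.2 B.1 B.2
      exact ⟨_, ⟨⟨C, hC⟩, rfl⟩, hF _ _ h1, hF _ _ h2⟩)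
    (by
      have hz : (0 : E) = T.symm (toCatL 0) := by rw [toCatL_zero, map_zero]
      refine ⟨?_, fun b hb => ?_⟩
      · rintro _ ⟨A, rfl⟩
        rw [hz, hT.symm_le_symm_iff]
        exact Eventually.of_forall fun x => indicator_nonneg (fun _ _ => zero_le_one) x
      · obtain ⟨u, hu⟩ := toCatL_surjective (T b)
        obtain rfl : T.symm (toCatL u) = b := by rw [hu, T.symm_apply_apply]
        rw [hz, hT.symm_le_symm_iff]
        exact h0 u fun A hA => hT.symm_le_symm_iff.1 (hb ⟨⟨A, hA⟩, rfl⟩)) hε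
  refine ⟨A.1, A.2, fun B hB hBA => ?_⟩
  rw [hμ.toFun_eq (hS B hB)]
  exact hA _ ⟨⟨B, hB⟩, rfl⟩ (hF ⟨A, A.2⟩ ⟨B, hB⟩ hBA)

theorem OrderContinuous.countablyAdditive (hφ : OrderContinuous φ) (hT : IsIdentification ι T)
    (hμ : Represents T μ φ) : μ.CountablyAdditive := by
  intro A hA hd
  have hm : ∀ F : Finset ℕ, MeasurableSet (⋃ n ∈ (F : Set ℕ)ᶜ, A n) := fun F =>
    MeasurableSet.biUnion (to_countable _) fun n _ => hA n
  have hsum : ∀ F : Finset ℕ, μ.toFun (⋃ n ∈ F, A n) = ∑ n ∈ F, μ.toFun (A n) := fun F => by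
    induction F using Finset.induction_on with
    | empty => simpa using μ.meagre ∅ IsMeagre.empty
    | insert a F ha ih =>
      rw [Finset.set_biUnion_insert, Finset.sum_insert ha, ← ih]
      refine μ.additive _ _ (hA a) (F.measurableSet_biUnion fun n _ => hA n) ?_
      exact disjoint_iUnion₂_right.2 fun n hn => hd fun h => ha (h ▸ hn)
  have htot : ∀ F : Finset ℕ, μ.toFun (⋃ n, A n) - ∑ n ∈ F, μ.toFun (A n) =
      μ.toFun (⋃ n ∈ (F : Set ℕ)ᶜ, A n) := fun F => by
    rw [← hsum, sub_eq_iff_eq_add', ← μ.additive _ _ (F.measurableSet_biUnion fun n _ => hA n)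
      (hm F)]
    · congr 1
      ext x
      simp only [mem_iUnion, mem_union, mem_compl_iff, Finset.mem_coe, exists_prop]
      grind
    · refine disjoint_iUnion₂_left.2 fun n hn => disjoint_iUnion₂_right.2 fun m hm => hd ?_
      rintro rfl
      exact hm hn
  have hmono : ∀ F G : Finset ℕ, F ⊆ G →
      (⋃ n ∈ (G : Set ℕ)ᶜ, A n) ⊆ ⋃ n ∈ (F : Set ℕ)ᶜ, A n := fun F G h =>
    biUnion_mono (compl_subset_compl.2 (by exact_mod_cast h)) fun _ _ => Subset.rfl
  rw [HasSum, SummationFilter.unconditional_filter, Metric.tendsto_atTop]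
  intro ε hε
  classical
  obtain ⟨_, ⟨F, rfl⟩, hF⟩ := hφ.exists_abs_toFun_lt hT hμ
    (S := range fun F : Finset ℕ => ⋃ n ∈ (F : Set ℕ)ᶜ, A n)
    (by rintro _ ⟨F, rfl⟩; exact hm F) (range_nonempty _)
    (by
      rintro _ ⟨F, rfl⟩ _ ⟨G, rfl⟩
      exact ⟨_, ⟨F ∪ G, rfl⟩, hmono _ _ Finset.subset_union_left,
        hmono _ _ Finset.subset_union_right⟩)
    (fun u hu => by
      -- There are countably many finite sets, so off one meagre set all inequalities hold at once;
      -- and each point is outside some tail, that of `{n}` if it lies in `A n`.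
      have hu' := eventually_countable_forall.2 fun F : Finset ℕ => hu _ ⟨F, rfl⟩
      refine hu'.mono fun x hx => ?_
      by_cases h : ∃ n, x ∈ A n
      · obtain ⟨n, hn⟩ := h
        have := hx {n}
        rwa [indicator_of_notMem] at this
        simp only [mem_iUnion, not_exists]
        intro m hm hxm
        exact disjoint_left.1 (hd fun h => hm (by simp [h])) hxm hn
      · have := hx ∅
        rwa [indicator_of_notMem] at this
        simpa using h) hε
  refine ⟨F, fun G hG => ?_⟩
  rw [dist_comm, Real.dist_eq, htot]
  exact hF _ ⟨G, rfl⟩ (hmono _ _ hG)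

variable [T2Space K]

/-- A continuous `f > 0` below the positive part of a common essential lower bound of the
neighbourhood indicators would be positive at some point off `F`, which a neighbourhood of `F` can
avoid. So the indicators have infimum `0`. -/
theorem OrderContinuous.exists_isOpen_totalVariation_lt (hφ : OrderContinuous φ)
    (hT : IsIdentification ι T) (hμ : Represents T μ φ) (h : μ.CountablyAdditive) {F : Set K}
    (hF : IsClosed F) (hF' : IsNowhereDense F) {ε : ℝ} (hε : 0 < ε) :
    ∃ G, IsOpen G ∧ F ⊆ G ∧ (CatFam.toSignedMeasure h).totalVariation.real G < ε := by
  have hFi : interior F = ∅ := by rw [← hF.closure_eq]; exact hF'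
  -- `φ` controls `μ` and not `|μ|`, so the neighbourhoods are cut by the Hahn set and by its
  -- complement. Smallness must persist for smaller `G'` so that the two choices can be intersected.
  have key : ∀ P : Set K, MeasurableSet P → ∃ G, (IsOpen G ∧ F ⊆ G) ∧
      ∀ G', IsOpen G' → F ⊆ G' → G' ⊆ G → |μ.toFun (G' ∩ P)| < ε / 2 := fun P hP => by
    obtain ⟨_, ⟨G, ⟨hG, hFG⟩, rfl⟩, H⟩ := hφ.exists_abs_toFun_lt hT hμ
      (S := (· ∩ P) '' {G | IsOpen G ∧ F ⊆ G})
      (by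
        rintro _ ⟨G, hG, rfl⟩
        exact (measurableSet_catAlg_of_isOpen hG.1).inter hP)
      ⟨_, univ, ⟨isOpen_univ, subset_univ _⟩, rfl⟩
      (by
        rintro _ ⟨G, hG, rfl⟩ _ ⟨G', hG', rfl⟩
        exact ⟨_, ⟨G ∩ G', ⟨hG.1.inter hG'.1, subset_inter hG.2 hG'.2⟩, rfl⟩,
          inter_subset_inter_left _ inter_subset_left,
          inter_subset_inter_left _ inter_subset_right⟩)
      (fun u hu => by
        by_contra H
        obtain ⟨f, hf0, hf⟩ := exists_continuousMap_pos_le u.2.1 H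
        have hne : ({x | 0 < f x} \ F).Nonempty := by
          by_contra! hE
          have hsub : {x | 0 < f x} ⊆ interior F :=
            interior_maximal (sdiff_eq_empty.1 hE) (isOpen_lt continuous_const f.continuous)
          rw [hFi] at hsub
          exact absurd (hf0.trans_le fun x => not_lt.1 fun hx => hsub hx) (lt_irrefl _)
        obtain ⟨x, hx, hxF⟩ := hne
        obtain ⟨V, W, hV, hW, hxV, hFW, hVW⟩ := SeparatedNhds.of_isCompact_isCompact
          (isCompact_singleton (x := x)) hF.isCompact (disjoint_singleton_left.2 hxF)
        obtain ⟨y, ⟨hyV, hy⟩, hyf, hyu⟩ := exists_mem_of_eventually_residual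
          (hV.inter (isOpen_lt continuous_const f.continuous)) ⟨x, hxV rfl, hx⟩
          (hf.and (hu _ ⟨W, ⟨hW, hFW⟩, rfl⟩))
        rw [indicator_of_notMem fun hyW => disjoint_left.1 hVW hyV hyW.1] at hyu
        rw [max_eq_right hyu] at hyf
        exact absurd hyf (not_le.2 hy)) (half_pos hε)
    refine ⟨G, ⟨hG, hFG⟩, fun G' hG' hFG' hGG' => ?_⟩
    exact H _ ⟨G', ⟨hG', hFG'⟩, rfl⟩ (inter_subset_inter_left _ hGG')
  obtain ⟨P, hP, -, -, hv⟩ := CatFam.exists_hahn h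
  obtain ⟨G₁, ⟨hG₁, hF₁⟩, H₁⟩ := key P hP
  obtain ⟨G₂, ⟨hG₂, hF₂⟩, H₂⟩ := key Pᶜ hP.compl
  refine ⟨G₁ ∩ G₂, hG₁.inter hG₂, subset_inter hF₁ hF₂, ?_⟩
  have h1 := abs_lt.1 (H₁ _ (hG₁.inter hG₂) (subset_inter hF₁ hF₂) inter_subset_left)
  have h2 := abs_lt.1 (H₂ _ (hG₁.inter hG₂) (subset_inter hF₁ hF₂) inter_subset_right)
  rw [hv _ (measurableSet_catAlg_of_isOpen (hG₁.inter hG₂)), sdiff_eq]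
  linarith [h1.2, h2.1]

end

section

variable [CompactSpace K] [T2Space K] {E : Type*} [NormedAddCommGroup E] [Lattice E]
  [NormedSpace ℝ E] {ι : C(K, ℝ) →ₗᵢ[ℝ] E} {T : E ≃ₗ[ℝ] CatL K} {φ : StrongDual ℝ E}
  {μ : CatFam K}

theorem OrderContinuous.exists_isCompact_totalVariation_le (hφ : OrderContinuous φ)
    (hT : IsIdentification ι T) (hμ : Represents T μ φ) (h : μ.CountablyAdditive) {B : Set K}
    (hB : MeasurableSet B) {ε : ℝ} (hε : 0 < ε) :
    ∃ C, IsCompact C ∧ C ⊆ B ∧ (CatFam.toSignedMeasure h).totalVariation.real B ≤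
      (CatFam.toSignedMeasure h).totalVariation.real C + ε := by
  set ν := (CatFam.toSignedMeasure h).totalVariation
  obtain ⟨V, N, hV, hN, rfl⟩ := (measurableSet_catAlg_iff K B).1 hB
  obtain ⟨S, hS, hSc, hNS⟩ := isMeagre_iff_countable_union_isNowhereDense.1 hN
  -- Covering `frontier V` along with `N` allows the compact `closure V` to replace `V` once the
  -- cover is removed.
  obtain ⟨f, hf⟩ := (hSc.insert (frontier V)).exists_eq_range (insert_nonempty _ _)
  have hfn : ∀ n, IsNowhereDense (f n) := fun n => by
    have hn : f n ∈ insert (frontier V) S := hf ▸ mem_range_self n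
    rcases hn with hn | hn
    · rw [hn, isClosed_frontier.isNowhereDense_iff, ← frontier_compl, interior_frontier hV.isClosed_compl]
    · exact hS _ hn
  obtain ⟨δ, hδ, hδε⟩ := ENNReal.exists_pos_sum_of_countable (ι := ℕ)
    (ENNReal.ofReal_pos.2 hε).ne'
  choose G hG hfG hνG using fun n => hφ.exists_isOpen_totalVariation_lt hT hμ h
    (isClosed_closure (s := f n)) (hfn n).closure (NNReal.coe_pos.2 (hδ n))
  have hνU : ν.real (⋃ n, G n) ≤ ε := by
    refine ENNReal.toReal_le_of_le_ofReal hε.le ?_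
    refine (measure_iUnion_le G).trans (le_trans (ENNReal.tsum_le_tsum fun n => ?_) hδε.le)
    rw [← ENNReal.ofReal_coe_nnreal]
    exact (ENNReal.le_ofReal_iff_toReal_le (measure_ne_top _ _) (hδ n).le).2 (hνG n).le
  have hfU : ∀ t ∈ insert (frontier V) S, t ⊆ ⋃ n, G n := fun t ht => by
    rw [hf] at ht
    obtain ⟨n, rfl⟩ := ht
    exact subset_closure.trans ((hfG n).trans (subset_iUnion G n))
  have hNU : N ⊆ ⋃ n, G n :=
    hNS.trans (sUnion_subset fun t ht => hfU t (mem_insert_of_mem _ ht))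
  have hVU : frontier V ⊆ ⋃ n, G n := hfU _ (mem_insert _ _)
  refine ⟨closure V \ ⋃ n, G n,
    (isClosed_closure.sdiff (isOpen_iUnion hG)).isCompact, fun x hx => ?_, ?_⟩
  · refine Or.inl ⟨by_contra fun hxV => hx.2 (hVU ?_), fun hxN => hx.2 (hNU hxN)⟩
    rw [hV.frontier_eq]
    exact ⟨hx.1, hxV⟩
  · refine le_trans (measureReal_mono ?_) ((measureReal_union_le _ _).trans
      (add_le_add_right hνU _))
    intro x hx
    by_cases hxU : x ∈ ⋃ n, G n
    · exact Or.inr hxU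
    · refine Or.inl ⟨subset_closure ?_, hxU⟩
      rcases hx with hx | hx
      · exact hx.1
      · exact absurd (hNU hx.1) hxU

theorem OrderContinuous.regularOn (hφ : OrderContinuous φ) (hT : IsIdentification ι T)
    (hμ : Represents T μ φ) (h : μ.CountablyAdditive) :
    μ.RegularOn {B | MeasurableSet[catAlg K] B} := by
  intro B hB
  change MeasurableSet B at hB
  set ν := (CatFam.toSignedMeasure h).totalVariation
  have hC : ∀ {C : Set K}, IsCompact C → μ.absVal C = ν.real C := fun {C} hC => by
    refine CatFam.absVal_eq h ?_
    rw [← compl_compl C]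
    exact (measurableSet_catAlg_of_isOpen hC.isClosed.isOpen_compl).compl
  have hU : ∀ {U : Set K}, IsOpen U → μ.absVal U = ν.real U := fun {U} hU =>
    CatFam.absVal_eq h (measurableSet_catAlg_of_isOpen hU)
  rw [CatFam.absVal_eq h hB]
  refine ⟨⟨?_, fun b hb => le_of_forall_pos_le_add fun ε hε => ?_⟩,
    ⟨?_, fun b hb => le_of_forall_pos_le_add fun ε hε => ?_⟩⟩
  · rintro _ ⟨C, ⟨hCB, hC'⟩, rfl⟩
    rw [hC hC']
    exact measureReal_mono hCB
  · obtain ⟨C, hC', hCB, hle⟩ := hφ.exists_isCompact_totalVariation_le hT hμ h hB hε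
    have := hb ⟨C, ⟨hCB, hC'⟩, rfl⟩
    rw [hC hC'] at this
    linarith
  · rintro _ ⟨U, ⟨hBU, hU'⟩, rfl⟩
    rw [hU hU']
    exact measureReal_mono hBU
  -- Outer regularity of `B` is inner regularity of `Bᶜ`, as the total variation is finite.
  · obtain ⟨C, hC', hCB, hle⟩ := hφ.exists_isCompact_totalVariation_le hT hμ h hB.compl hε
    have := hb ⟨Cᶜ, ⟨subset_compl_comm.1 hCB, hC'.isClosed.isOpen_compl⟩, rfl⟩
    rw [hU hC'.isClosed.isOpen_compl] at this
    have hCm : MeasurableSet C := by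
      rw [← compl_compl C]
      exact (measurableSet_catAlg_of_isOpen hC'.isClosed.isOpen_compl).compl
    have h1 := measureReal_add_measureReal_compl (μ := ν) hB
    have h2 := measureReal_add_measureReal_compl (μ := ν) hCm
    linarith

end

/-! ### From regularity to order continuity -/

section

variable {E : Type*} [NormedAddCommGroup E] [NormedSpace ℝ E]
  {T : E ≃ₗ[ℝ] CatL K} {φ : StrongDual ℝ E} {μ : CatFam K}

/-- The product of a bounded measurable function with the indicator function of a set. -/
def restrictCatB (u : CatB K) (A : Set K) (hA : MeasurableSet A) : CatB K :=
  ⟨A.indicator u, u.2.1.indicator hA, by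
    obtain ⟨M, hM⟩ := u.2.2
    refine ⟨M, fun x => ?_⟩
    by_cases h : x ∈ A
    · simpa [h] using hM x
    · simpa [h] using (abs_nonneg _).trans (hM x)⟩

theorem Represents.abs_functionalCatB_simple_le (hμ : Represents T μ φ) (h : μ.CountablyAdditive)
    (s : SimpleFunc K ℝ) {A : Set K} (hA : MeasurableSet A) {c : ℝ} (hs : ∀ x ∈ A, |s x| ≤ c) :
    |functionalCatB T φ (restrictCatB (simpleCatB s) A hA)| ≤
      c * (CatFam.toSignedMeasure h).totalVariation.real A := by
  set ν := (CatFam.toSignedMeasure h).totalVariation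
  have hm : ∀ y, MeasurableSet (s ⁻¹' {y} ∩ A) := fun y => (s.measurableSet_fiber y).inter hA
  have hdec : restrictCatB (simpleCatB s) A hA =
      ∑ y ∈ s.range, y • indicatorCatB (s ⁻¹' {y} ∩ A) (hm y) := by
    ext x
    have h1 := congrFun (congrArg Subtype.val (simpleCatB_eq_sum s)) x
    by_cases hx : x ∈ A
    · simpa [restrictCatB, indicatorCatB, hx, Finset.sum_apply, indicator] using h1
    · simp [restrictCatB, indicatorCatB, hx, Finset.sum_apply]
  rw [hdec, map_sum]
  refine (Finset.abs_sum_le_sum_abs _ _).trans ?_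
  have hterm : ∀ y ∈ s.range, |functionalCatB T φ (y • indicatorCatB (s ⁻¹' {y} ∩ A) (hm y))| ≤
      c * ν.real (s ⁻¹' {y} ∩ A) := fun y _ => by
    rw [map_smul, ← hμ.toFun_eq (hm y), smul_eq_mul, abs_mul]
    -- The bound `|y| ≤ c` is known only for values attained on `A`.
    rcases (s ⁻¹' {y} ∩ A).eq_empty_or_nonempty with he | ⟨x, hx, hxA⟩
    · rw [he, μ.meagre ∅ IsMeagre.empty]
      simp
    · have hy : |y| ≤ c := by
        rw [← show s x = y from hx]
        exact hs x hxA
      exact mul_le_mul hy (CatFam.abs_toFun_le h (hm y)) (abs_nonneg _) ((abs_nonneg y).trans hy)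
  refine (Finset.sum_le_sum hterm).trans ?_
  rw [← Finset.mul_sum, ← measureReal_biUnion_finset
    (fun y _ z _ hyz => disjoint_left.2 fun x hx hx' => hyz (hx.1.symm.trans hx'.1))
    fun y _ => hm y]
  refine le_of_eq (congrArg (fun t => c * ν.real t) ?_)
  ext x
  simp

theorem Represents.abs_functionalCatB_restrict_le [CompactSpace K] [Lattice E]
    [IsOrderedAddMonoid E] [HasSolidNorm E] {ι : C(K, ℝ) →ₗᵢ[ℝ] E}
    (hT : IsIdentification ι T) (hμ : Represents T μ φ)
    (h : μ.CountablyAdditive) (u : CatB K) {A : Set K} (hA : MeasurableSet A) {c : ℝ}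
    (hu : ∀ x ∈ A, |(u : K → ℝ) x| ≤ c) :
    |functionalCatB T φ (restrictCatB u A hA)| ≤
      c * (CatFam.toSignedMeasure h).totalVariation.real A := by
  set ν := (CatFam.toSignedMeasure h).totalVariation
  -- The error has two sources: a `δ`-close simple function is bounded on `A` by `c + δ`, and
  -- exchanging it for `u` costs `‖φ‖ * δ`.
  have key : ∀ δ > 0, |functionalCatB T φ (restrictCatB u A hA)| ≤
      c * ν.real A + δ * (ν.real A + ‖φ‖) := fun δ hδ => by
    obtain ⟨s, hs⟩ := CatFam.exists_simpleFunc_near u hδ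
    have h1 := hμ.abs_functionalCatB_simple_le h s hA (c := c + δ) fun x hx => by
      have h3 := abs_sub_abs_le_abs_sub (s x) ((u : K → ℝ) x)
      linarith [hs x, hu x hx]
    have h2 := hT.abs_functionalCatB_le (φ := φ)
      (u := restrictCatB (simpleCatB s) A hA - restrictCatB u A hA) hδ.le fun x => by
        by_cases hx : x ∈ A
        · simpa [restrictCatB, simpleCatB, hx] using hs x
        · simpa [restrictCatB, hx] using hδ.le
    rw [map_sub, abs_sub_comm] at h2
    have h3 := abs_sub_abs_le_abs_sub (functionalCatB T φ (restrictCatB u A hA))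
      (functionalCatB T φ (restrictCatB (simpleCatB s) A hA))
    nlinarith
  refine le_of_forall_pos_le_add fun ε hε => ?_
  have hpos : 0 < ν.real A + ‖φ‖ + 1 := by positivity
  refine (key (ε / (ν.real A + ‖φ‖ + 1)) (by positivity)).trans (add_le_add_right ?_ _)
  rw [div_mul_eq_mul_div, div_le_iff₀ hpos]
  nlinarith

end

section

variable [CompactSpace K] [T2Space K] {E : Type*} [NormedAddCommGroup E] [Lattice E]
  [IsOrderedAddMonoid E] [NormedSpace ℝ E]
  {ι : C(K, ℝ) →ₗᵢ[ℝ] E} {T : E ≃ₗ[ℝ] CatL K} {φ : StrongDual ℝ E} {μ : CatFam K}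

/-- A continuous `h > 0` below `δ` times the indicator of the interior would be below every
continuous majorant of every `f ∈ D`. Then `ι h` would be a lower bound of `D`. -/
theorem IsDedekindCompletion.isNowhereDense_of_isGLB_zero (hι : IsDedekindCompletion ι)
    {D : Set E} (h0 : IsGLB D 0) {δ : ℝ} (hδ : 0 < δ) :
    interior {x | ∀ g : C(K, ℝ), (∃ f ∈ D, f ≤ ι g) → δ ≤ g x} = ∅ := by
  by_contra! hne
  obtain ⟨h, hh0, hh⟩ := exists_continuousMap_le_indicator isOpen_interior hne hδ
  have hhD : ι h ≤ 0 := h0.2 fun f hf => hι.le_of_forall_le_map fun g hg => by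
    refine hι.map_le_map_iff.2 fun x => (hh x).trans ?_
    refine indicator_le' (fun x hx => ?_) (fun x _ => ?_) x
    · have hx' : ∀ g : C(K, ℝ), (∃ f ∈ D, f ≤ ι g) → δ ≤ g x := interior_subset hx
      exact hx' g ⟨f, hf, hg⟩
    · have := (h0.1 hf).trans hg
      rw [← map_zero ι, hι.map_le_map_iff] at this
      exact this x
  rw [← map_zero ι, hι.map_le_map_iff] at hhD
  exact absurd (hh0.trans_le hhD) (lt_irrefl _)

theorem orderContinuous_of_regularOn [HasSolidNorm E] [IsOrderedModule ℝ E] (hι : IsDedekindCompletion ι)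
    (hT : IsIdentification ι T) (hμ : Represents T μ φ) (h : μ.CountablyAdditive)
    (hreg : μ.RegularOn {B | MeasurableSet[borel K] B}) : OrderContinuous φ := by
  intro D hne hdir h0
  refine ⟨by rintro _ ⟨f, _, rfl⟩; exact abs_nonneg _, fun b hb => ?_⟩
  refine le_of_forall_pos_le_add fun ε hε => ?_
  rw [zero_add]
  set ν := (CatFam.toSignedMeasure h).totalVariation
  obtain ⟨f₀, hf₀⟩ := hne
  obtain ⟨g₀, hg₀⟩ := hι.exists_le_map f₀
  -- `δ` and `η` make the contributions of `Uᶜ` and `U` at most `ε / 2` each; the added `1` avoids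
  -- division by zero.
  set δ : ℝ := ε / (2 * (ν.real univ + 1)) with hδ_def
  have hδ : 0 < δ := by positivity
  set η : ℝ := ε / (2 * (‖g₀‖ + 1)) with hη_def
  have hη : 0 < η := by positivity
  let F : Set K := {x | ∀ g : C(K, ℝ), (∃ f ∈ D, f ≤ ι g) → δ ≤ g x}
  have hFc : IsClosed F := by
    simp only [F, ofPred_forall]
    exact isClosed_iInter fun g => isClosed_iInter fun _ => isClosed_le continuous_const g.continuous
  have hFn : IsNowhereDense F :=
    hFc.isNowhereDense_iff.2 (hι.isNowhereDense_of_isGLB_zero h0 hδ)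
  have hFm : IsMeagre F := hFn.isMeagre
  obtain ⟨U, hFU, hU, hUη⟩ : ∃ U, F ⊆ U ∧ IsOpen U ∧ ν.real U < η := by
    by_contra! H
    have hFb : MeasurableSet[borel K] F := by
      let _ := borel K
      have _h : BorelSpace K := ⟨rfl⟩
      exact hFc.measurableSet
    have : η ≤ μ.absVal F := (hreg F hFb).2.2 (by
      rintro _ ⟨U, ⟨hFU, hU⟩, rfl⟩
      rw [CatFam.absVal_eq h (measurableSet_catAlg_of_isOpen hU)]
      exact H U hFU hU)
    rw [CatFam.absVal_eq h (measurableSet_catAlg_of_isMeagre hFm),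
      CatFam.totalVariation_isMeagre h hFm] at this
    exact absurd this (not_le.2 hη)
  obtain ⟨g, f, hf, hfg, hgg, hgU⟩ : ∃ g : C(K, ℝ), ∃ f ∈ D, f ≤ ι g ∧ g ≤ g₀ ∧
      ∀ x ∉ U, g x < δ := by
    -- The condition `g ≤ g₀` keeps the uniform bound `‖g₀‖` on `U`, where smallness is not
    -- available.
    let I := {g : C(K, ℝ) // (∃ f ∈ D, f ≤ ι g) ∧ g ≤ g₀}
    have hI : Nonempty I := ⟨⟨g₀, ⟨f₀, hf₀, hg₀⟩, le_rfl⟩⟩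
    obtain ⟨g, hg⟩ := hU.isClosed_compl.isCompact.elim_directed_cover
      (fun g : I => {x | g.1 x < δ}) (fun g => isOpen_lt g.1.continuous continuous_const)
      (fun x hx => by
        have : x ∉ F := fun hxF => hx (hFU hxF)
        simp only [F, mem_ofPred_eq, not_forall, not_le] at this
        obtain ⟨g, ⟨f, hf, hfg⟩, hgx⟩ := this
        obtain ⟨f', hf', h1, h2⟩ := hdir f hf f₀ hf₀
        refine mem_iUnion.2 ⟨⟨g ⊓ g₀, ⟨f', hf', ?_⟩, inf_le_right⟩, ?_⟩
        · rw [hι.map_inf]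
          exact le_inf (h1.trans hfg) (h2.trans hg₀)
        · exact lt_of_le_of_lt (min_le_left _ _) hgx)
      (by
        rintro ⟨g, ⟨f, hf, hfg⟩, hg⟩ ⟨g', ⟨f', hf', hfg'⟩, hg'⟩
        obtain ⟨k, hk, h1, h2⟩ := hdir f hf f' hf'
        refine ⟨⟨g ⊓ g', ⟨k, hk, ?_⟩, inf_le_left.trans hg⟩, fun x (hx : g x < δ) => ?_,
          fun x (hx : g' x < δ) => ?_⟩
        · rw [hι.map_inf]
          exact le_inf (h1.trans hfg) (h2.trans hfg')
        · exact lt_of_le_of_lt (min_le_left _ _) hx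
        · exact lt_of_le_of_lt (min_le_right _ _) hx)
    obtain ⟨⟨f, hf, hfg⟩, hgg⟩ := g.2
    exact ⟨g.1, f, hf, hfg, hgg, fun x hx => hg hx⟩
  refine (hb ⟨f, hf, rfl⟩).trans ?_
  -- This representative satisfies `0 ≤ v ≤ g` at every point, not only off a meagre set.
  let v : CatB K := hι.lowerEnvelopeCatB f
  have hv : φ f = functionalCatB T φ v := by
    rw [functionalCatB_apply, T.eq_symm_apply.2 (show T f = toCatL v by
      rw [hι.eq_catLEquiv hT]; rfl)]
  have hvg : ∀ x, (v : K → ℝ) x ≤ g x := fun x =>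
    (hι.lowerEnvelope_le_upperEnvelope f x).trans (hι.upperEnvelope_le hfg x)
  have hv0 : ∀ x, 0 ≤ (v : K → ℝ) x :=
    hι.le_lowerEnvelope (f := 0) (by rw [map_zero]; exact h0.1 hf)
  have hUm := measurableSet_catAlg_of_isOpen hU
  have hsplit : v = restrictCatB v U hUm + restrictCatB v Uᶜ hUm.compl :=
    Subtype.ext (indicator_self_add_compl U (v : K → ℝ)).symm
  have h1 := hμ.abs_functionalCatB_restrict_le hT h v hUm (c := ‖g₀‖) fun x _ => by
    rw [abs_of_nonneg (hv0 x)]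
    exact (hvg x).trans ((hgg x).trans ((le_abs_self _).trans (g₀.norm_coe_le_norm x)))
  have h2 := hμ.abs_functionalCatB_restrict_le hT h v hUm.compl (c := δ) fun x hx => by
    rw [abs_of_nonneg (hv0 x)]
    exact (hvg x).trans (hgU x hx).le
  have h3 : ν.real Uᶜ ≤ ν.real univ := measureReal_mono (subset_univ _)
  have h4 : ‖g₀‖ * η ≤ ε / 2 := by
    rw [hη_def, mul_div_assoc', div_le_div_iff₀ (by positivity) two_pos]
    nlinarith [norm_nonneg g₀]
  have h5 : δ * ν.real univ ≤ ε / 2 := by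
    rw [hδ_def, div_mul_eq_mul_div, div_le_div_iff₀ (by positivity) two_pos]
    nlinarith [measureReal_nonneg (μ := ν) (s := univ)]
  change |φ f| ≤ ε
  rw [hv, hsplit, map_add]
  calc _ ≤ _ := abs_add_le _ _
    _ ≤ ‖g₀‖ * ν.real U + δ * ν.real Uᶜ := add_le_add h1 h2
    _ ≤ ‖g₀‖ * η + δ * ν.real univ := by gcongr
    _ ≤ ε := by linarith

end

end CKDual

end

theorem mainTheorem5
    (K : Type*) [TopologicalSpace K] [CompactSpace K] [T2Space K]
    (E : Type*) [NormedAddCommGroup E] [Lattice E] [IsOrderedAddMonoid E] [HasSolidNorm E]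
    [NormedSpace ℝ E] [IsOrderedModule ℝ E] [CompleteSpace E]
    (ι : C(K, ℝ) →ₗᵢ[ℝ] E) (hι : CKDual.IsDedekindCompletion ι) :
    (∃! T : E ≃ₗ[ℝ] CKDual.CatL K, CKDual.IsIdentification ι T) ∧
    ∀ T : E ≃ₗ[ℝ] CKDual.CatL K, CKDual.IsIdentification ι T →
      ∀ φ : StrongDual ℝ E,
        (∃! μ : CKDual.CatFam K, CKDual.Represents T μ φ) ∧
        ∀ μ : CKDual.CatFam K, CKDual.Represents T μ φ →
          (CKDual.OrderContinuous φ ↔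
            μ.CountablyAdditive ∧ μ.RegularOn {B | MeasurableSet[borel K] B}) ∧
          (CKDual.OrderContinuous φ ↔
            μ.CountablyAdditive ∧ μ.RegularOn {B | MeasurableSet[CKDual.catAlg K] B}) := by
  refine ⟨⟨hι.catLEquiv, hι.isIdentification_catLEquiv, fun T hT => hι.eq_catLEquiv hT⟩,
    fun T hT φ => ⟨hT.existsUnique_represents φ, fun μ hμ => ?_⟩⟩
  have h13 : CKDual.OrderContinuous φ →
      μ.CountablyAdditive ∧ μ.RegularOn {B | MeasurableSet[CKDual.catAlg K] B} := fun hφ =>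
    have h := hφ.countablyAdditive hT hμ
    ⟨h, hφ.regularOn hT hμ h⟩
  have h32 : μ.RegularOn {B | MeasurableSet[CKDual.catAlg K] B} →
      μ.RegularOn {B | MeasurableSet[borel K] B} := fun h B hB => h B (CKDual.borel_le_catAlg B hB)
  have h21 : μ.CountablyAdditive ∧ μ.RegularOn {B | MeasurableSet[borel K] B} →
      CKDual.OrderContinuous φ := fun h => CKDual.orderContinuous_of_regularOn hι hT hμ h.1 h.2
  exact ⟨⟨fun hφ => ⟨(h13 hφ).1, h32 (h13 hφ).2⟩, h21⟩, ⟨h13, fun h => h21 ⟨h.1, h32 h.2⟩⟩⟩
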